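/- Let $\mathfrak c$ be the cardinality of the continuum, and let $\mathfrak p$ be the least cardinality of a family $\mathcal F$ of subsets of $\mathbb N$ such that every finite subfamily of $\mathcal F$ has infinite intersection, but there is no infinite $P\subseteq\mathbb N$ with $P\setminus A$ finite for all $A\in\mathcal F$. A topological space is called strongly sequentially separable if it is separable and, for each of its countable dense subsets $D$, every point of the space is the limit of a sequence of elements of $D$. For a topological space $X$ let $C_p(X)$ be the set of continuous functions $X\to\mathbb R$ and $B_1(X)$ the set of pointwise limits of sequences of continuous functions $X\to\mathbb R$, both with the topology of pointwise convergence. A family $\mathcal U$ of subsets of $X$ is an $\omega$-cover if $X\notin\mathcal U$ and every finite subset of $X$ is contained in a member of $\mathcal U$; it is a $\gamma$-cover if it is infinite and each $x\in X$ belongs to all but finitely many members of $\mathcal U$. Let $\Omega$ and $\Gamma$ be the collections of all $\omega$-covers, respectively $\gamma$-covers, of $X$ by open sets, and $F_\Omega$ and $F_\Gamma$ the collections of all countable $\omega$-covers, respectively countable $\gamma$-covers, of $X$ by closed sets. $X$ is a $\gamma$-set if every $\mathcal U\in\Omega$ contains a sequence $(b_n)_{n\in\mathbb N}$ of members with $\{b_n:n\in\mathbb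 N\}\in\Gamma$. The principle $S_1(\mathcal A,\mathcal B)$ says that for each sequence $(A_n)_{n\in\mathbb N}$ of elements of $\mathcal A$ there are $b_n\in A_n$ $(n\in\mathbb N)$ such that $\{b_n:n\in\mathbb N\}\in\mathcal B$. **Theorem.** Assume $\mathfrak p=\mathfrak c$. Then there is a zero-dimensional set $X\subseteq\mathbb R$ (that is, the clopen subsets of $X$ form a base of its subspace topology) with all of the following properties: 1. $C_p(X)$ is strongly sequentially separable; 2. $B_1(X)$ is not strongly sequentially separable; 3. $X$ is a $\gamma$-set; 4. there is a Borel function $f:X\to\mathbb R$ with $f(X)=[0,1]$; 5. $X$ satisfies $S_1(\Omega,\Gamma)$; 6. $X$ does not satisfy $S_1(F_\Omega,F_\Gamma)$. -/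

import Mathlib

open Set Filter Topology

/-- A family of sets of natural numbers has the strong finite intersection property if all its
finite subfamilies have infinite intersection. -/
def HasSFIP (F : Set (Set ℕ)) : Prop :=
  ∀ s : Finset (Set ℕ), (s : Set (Set ℕ)) ⊆ F → (⋂ A ∈ s, A).Infinite

/-- `P` is an infinite pseudo-intersection of `F`: it is infinite and almost contained in every
member of `F`. -/
def IsPseudoIntersection (F : Set (Set ℕ)) (P : Set ℕ) : Prop :=
  P.Infinite ∧ ∀ A ∈ F, (P \ A).Finite

/-- The cardinal `𝔭`: the least cardinality of a family of sets of natural numbers which has the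
strong finite intersection property but no infinite pseudo-intersection. -/
noncomputable def pseudoIntersectionNumber : Cardinal.{0} :=
  sInf {κ | ∃ F : Set (Set ℕ), HasSFIP F ∧ (¬ ∃ P, IsPseudoIntersection F P) ∧
    Cardinal.mk F = κ}

/-- A space is strongly sequentially separable if it is separable and every countable dense subset
is sequentially dense, i.e. every point is the limit of a sequence from that subset. -/
def StronglySequentiallySeparable (Y : Type*) [TopologicalSpace Y] : Prop :=
  TopologicalSpace.SeparableSpace Y ∧
    ∀ D : Set Y, D.Countable → Dense D → seqClosure D = univ

/-- The continuous real functions on `X`. As a type it carries the subspace topology from the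
product `X → ℝ`, i.e. the topology of pointwise convergence. -/
def Cp (X : Type*) [TopologicalSpace X] : Set (X → ℝ) :=
  {f | Continuous f}

/-- The real functions of the first Baire class on `X`, i.e. the pointwise limits of sequences of
continuous functions. As a type it carries the topology of pointwise convergence. -/
def BaireOne (X : Type*) [TopologicalSpace X] : Set (X → ℝ) :=
  {f | ∃ u : ℕ → X → ℝ, (∀ n, Continuous (u n)) ∧
    ∀ x, Tendsto (fun n => u n x) atTop (𝓝 (f x))}

/-- A family is an `ω`-cover if it does not contain the whole space and every finite subset of the
space is contained in one of its members. -/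
def IsOmegaCover {X : Type*} (U : Set (Set X)) : Prop :=
  univ ∉ U ∧ ∀ K : Set X, K.Finite → ∃ V ∈ U, K ⊆ V

/-- A family is a `γ`-cover if it is infinite and every point belongs to all but finitely many of
its members. -/
def IsGammaCover {X : Type*} (U : Set (Set X)) : Prop :=
  U.Infinite ∧ ∀ x : X, {V ∈ U | x ∉ V}.Finite

/-- `Ω`: the open `ω`-covers of `X`. -/
def openOmega (X : Type*) [TopologicalSpace X] : Set (Set (Set X)) :=
  {U | (∀ V ∈ U, IsOpen V) ∧ IsOmegaCover U}

/-- `Γ`: the open `γ`-covers of `X`. -/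
def openGamma (X : Type*) [TopologicalSpace X] : Set (Set (Set X)) :=
  {U | (∀ V ∈ U, IsOpen V) ∧ IsGammaCover U}

/-- `F_Ω`: the countable closed `ω`-covers of `X`. -/
def closedOmega (X : Type*) [TopologicalSpace X] : Set (Set (Set X)) :=
  {U | U.Countable ∧ (∀ V ∈ U, IsClosed V) ∧ IsOmegaCover U}

/-- `F_Γ`: the countable closed `γ`-covers of `X`. -/
def closedGamma (X : Type*) [TopologicalSpace X] : Set (Set (Set X)) :=
  {U | U.Countable ∧ (∀ V ∈ U, IsClosed V) ∧ IsGammaCover U}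

/-- The selection principle `S₁(𝒜, ℬ)`. -/
def SelectionOne {X : Type*} (𝒜 ℬ : Set (Set (Set X))) : Prop :=
  ∀ A : ℕ → Set (Set X), (∀ n, A n ∈ 𝒜) →
    ∃ b : ℕ → Set X, (∀ n, b n ∈ A n) ∧ range b ∈ ℬ

/-- `X` is a `γ`-set: every open `ω`-cover contains a sequence which is a `γ`-cover. -/
def IsGammaSet (X : Type*) [TopologicalSpace X] : Prop :=
  ∀ U ∈ openOmega X, ∃ b : ℕ → Set X, (∀ n, b n ∈ U) ∧ range b ∈ openGamma X

/-! The set `X` is built inside the compact space of partial functions from ℕ to two symbols, then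
embedded in ℝ. It consists of the countable set `Q` of points with finite domain and of one point
with domain `A a` for each `a` below 𝔠, where the infinite sets `A a` decrease modulo finite sets.
The symbols on `A a` are free, so they can code any element of the Cantor space.

Stage `a` also treats one sequence of clopen families. If it covers the finite subsets of `Q` and of
the earlier points, `exists_absorbing_pseudoIntersection` chooses `A a` so sparse that one selection
eventually contains all earlier points and every point with domain almost contained in `A a`. All
later points are of this kind. Thus `X` satisfies `SelectsEventually`, which yields the properties
of open covers and of `Cp X`.

For the negative half, `decode` reads off the coded sequence and is continuous off `Q`, so the
complement of `Q` maps continuously onto the Cantor space; composing with a surjection onto [0,1]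
gives the Borel function. Both negated properties would imply `ClosedSubselects`. That property
makes the complement of `Q` an increasing union of closed sets, and a diagonal argument along the
map onto the Cantor space then refutes it. -/

/-- Fewer than `𝔭` sets of natural numbers with infinite finite intersections have an infinite
pseudo-intersection. -/
theorem exists_pseudoIntersection_of_lt {ι : Type} (D : ι → Set ℕ)
    (hι : Cardinal.mk ι < pseudoIntersectionNumber)
    (hD : ∀ s : Finset ι, (⋂ i ∈ s, D i).Infinite) :
    ∃ P : Set ℕ, P.Infinite ∧ ∀ i, (P \ D i).Finite := by
  by_contra hne
  have hmem : Cardinal.mk (range D) ∈ {κ | ∃ F : Set (Set ℕ), HasSFIP F ∧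
      (¬ ∃ P, IsPseudoIntersection F P) ∧ Cardinal.mk F = κ} := by
    refine ⟨range D, ?_, ?_, rfl⟩
    · intro s hs
      classical
      rw [← image_univ, Finset.subset_set_image_iff] at hs
      obtain ⟨t, -, rfl⟩ := hs
      refine (hD t).mono ?_
      intro x hx
      simp only [mem_iInter, Finset.mem_image] at hx ⊢
      rintro _ ⟨i, hi, rfl⟩
      exact hx i hi
    · rintro ⟨P, hP, h⟩
      exact hne ⟨P, hP, fun i => h _ (mem_range_self i)⟩
  exact absurd (((csInf_le' hmem).trans Cardinal.mk_range_le).trans_lt hι) (lt_irrefl _)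

/-- The version of `exists_pseudoIntersection_of_lt` for subsets of an arbitrary countable type. -/
theorem exists_pseudoIntersection_of_countable {ι Q : Type} [Countable Q] [Infinite Q]
    (D : ι → Set Q) (hι : Cardinal.mk ι < pseudoIntersectionNumber)
    (hD : ∀ s : Finset ι, (⋂ i ∈ s, D i).Infinite) :
    ∃ P : Set Q, P.Infinite ∧ ∀ i, (P \ D i).Finite := by
  obtain ⟨e⟩ := nonempty_equiv_of_countable (α := Q) (β := ℕ)
  obtain ⟨P, hP, h⟩ := exists_pseudoIntersection_of_lt (fun i => e.symm ⁻¹' D i) hι (by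
    intro s
    have := (hD s).image e.injective.injOn
    refine this.mono ?_
    rintro _ ⟨x, hx, rfl⟩
    simpa using hx)
  refine ⟨e.symm '' P, hP.image e.symm.injective.injOn, fun i => ?_⟩
  refine ((h i).image e.symm).subset ?_
  rintro _ ⟨⟨x, hx, rfl⟩, hx'⟩
  exact ⟨x, ⟨hx, hx'⟩, rfl⟩

/-! ### Partial sequences and gaps in their domains -/

/-- Sequences of three symbols. The symbol `0` stands for an undefined entry, so that a point is a
partial function from the natural numbers to two symbols. -/
abbrev PartialSeq : Type := ℕ → Fin 3

/-- The domain of a partial sequence. -/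
def PartialSeq.dom (x : PartialSeq) : Set ℕ := {n | x n ≠ 0}

theorem PartialSeq.mem_dom {x : PartialSeq} {n : ℕ} : n ∈ x.dom ↔ x n ≠ 0 := Iff.rfl

theorem PartialSeq.finite_setOf_dom_subset_Iio (l : ℕ) :
    {x : PartialSeq | x.dom ⊆ Iio l}.Finite := by
  refine Set.Finite.of_injOn (f := fun (x : PartialSeq) (i : Fin l) => x i) (t := univ)
    (fun _ _ => mem_univ _) ?_ finite_univ
  intro x hx y hy hxy
  ext1 n
  by_cases hn : n < l
  · exact congrFun hxy ⟨n, hn⟩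
  · have h1 : x n = 0 := by
      by_contra h
      exact hn (hx h)
    have h2 : y n = 0 := by
      by_contra h
      exact hn (hy h)
    rw [h1, h2]

theorem PartialSeq.countable_setOf_finite_dom : {x : PartialSeq | x.dom.Finite}.Countable := by
  have : {x : PartialSeq | x.dom.Finite} ⊆ ⋃ l : ℕ, {x : PartialSeq | x.dom ⊆ Iio l} := by
    intro x hx
    obtain ⟨l, hl⟩ := Set.Finite.bddAbove hx
    exact mem_iUnion.2 ⟨l + 1, fun n hn => Nat.lt_succ_of_le (hl hn)⟩
  exact (countable_iUnion fun l =>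
    (PartialSeq.finite_setOf_dom_subset_Iio l).countable).mono this

/-- An open set containing all partial sequences with domain below `l` contains all partial
sequences that are undefined on a sufficiently long interval starting at `l`. -/
theorem PartialSeq.exists_gap (l : ℕ) (B : Set PartialSeq) (hB : IsOpen B)
    (h : ∀ x : PartialSeq, x.dom ⊆ Iio l → x ∈ B) :
    ∃ m : ℕ, ∀ x : PartialSeq, Disjoint x.dom (Ico l m) → x ∈ B := by
  have hcl : ∀ m, IsClosed {x : PartialSeq | Disjoint x.dom (Ico l m)} := by
    intro m
    have : {x : PartialSeq | Disjoint x.dom (Ico l m)} =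
        ⋂ n ∈ Ico l m, {x : PartialSeq | x n = 0} := by
      ext x
      simp only [mem_ofPred_eq, Set.disjoint_right, PartialSeq.mem_dom, mem_iInter, not_not]
    rw [this]
    exact isClosed_biInter fun n _ => isClosed_eq (continuous_apply n) continuous_const
  -- As `m` grows, these compact sets decrease to the set of points with domain below `l`, which
  -- lies in `B`.
  obtain ⟨m, hm⟩ := exists_subset_nhds_of_isCompact'
    (V := fun m => {x : PartialSeq | Disjoint x.dom (Ico l m)})
    (by
      refine Antitone.directed_ge ?_
      intro a b hab x hx
      exact Disjoint.mono_right (Ico_subset_Ico_right hab) hx)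
    (fun m => (hcl m).isCompact) hcl (U := B) (by
      intro x hx
      refine hB.mem_nhds (h x ?_)
      intro n hn
      by_contra hnl
      have := mem_iInter.1 hx (n + 1)
      exact Set.disjoint_left.1 this hn ⟨not_lt.1 hnl, Nat.lt_succ_self n⟩)
  exact ⟨m, fun x hx => hm hx⟩

/-! ### One stage of the construction -/

/-- If fewer than `𝔭` sets of natural numbers have infinite finite intersections, then there is a
pseudo-intersection `A` and a selection from the given sequence of clopen `ω`-covers such that the
selected sets eventually contain every given point and every partial sequence whose domain is almost
contained in `A`. -/
theorem exists_absorbing_pseudoIntersection {ι : Type}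
    (hι : Cardinal.mk ι < pseudoIntersectionNumber)
    (hω : Cardinal.aleph0 < pseudoIntersectionNumber) (T : ι → Set ℕ)
    (hT : ∀ s : Finset ι, (⋂ i ∈ s, T i).Infinite) (z : ι → PartialSeq)
    (W : ℕ → Set (TopologicalSpace.Clopens PartialSeq))
    (hW : ∀ n, ∀ K : Set PartialSeq, K.Finite → (∀ x ∈ K, x.dom.Finite ∨ x ∈ range z) →
      ∃ B ∈ W n, K ⊆ B) :
    ∃ A : Set ℕ, A.Infinite ∧ (∀ i, (A \ T i).Finite) ∧
      ∃ b : ℕ → TopologicalSpace.Clopens PartialSeq, (∀ n, b n ∈ W n) ∧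
        (∀ i, ∀ᶠ n in atTop, z i ∈ b n) ∧
        ∀ x : PartialSeq, (x.dom \ A).Finite → ∀ᶠ n in atTop, x ∈ b n := by
  classical
  obtain ⟨P, hP, hPT⟩ := exists_pseudoIntersection_of_lt T hι hT
  -- Good lists are finite selections. A pseudo-intersection in the countable set of lists yields
  -- arbitrarily long good ones such that each `z i` belongs to all entries of almost all of them.
  let Good : Set (List (TopologicalSpace.Clopens PartialSeq)) :=
    {q | (∀ i (h : i < q.length), q[i] ∈ W i) ∧
      ∀ x : PartialSeq, x.dom ⊆ Iio q.length → ∀ B ∈ q, x ∈ B}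
  let D : ℕ ⊕ ι → Set (List (TopologicalSpace.Clopens PartialSeq)) :=
    Sum.elim (fun k => {q | q ∈ Good ∧ k ≤ q.length}) (fun i => {q | ∀ B ∈ q, z i ∈ B})
  have : Countable (TopologicalSpace.Clopens PartialSeq) :=
    TopologicalSpace.Clopens.countable_iff_secondCountable.2 inferInstance
  have hcard : Cardinal.mk (ℕ ⊕ ι) < pseudoIntersectionNumber := by
    rw [Cardinal.mk_sum]
    simpa using Cardinal.add_lt_of_lt hω.le hω hι
  obtain ⟨R, hR, hRD⟩ := exists_pseudoIntersection_of_countable D hcard (by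
    intro s
    refine Set.Infinite.of_image List.length (Set.infinite_of_forall_exists_gt fun N => ?_)
    obtain ⟨M, hM⟩ : ∃ M : ℕ, ∀ k, Sum.inl k ∈ s → k ≤ M := by
      obtain ⟨M, hM⟩ := (s.preimage Sum.inl Sum.inl_injective.injOn).bddAbove
      exact ⟨M, fun k hk => hM (by simpa using hk)⟩
    let l := max M (N + 1)
    let K : Set PartialSeq := {x | x.dom ⊆ Iio l} ∪
      z '' (s.preimage Sum.inr Sum.inr_injective.injOn : Finset ι)
    have hK : K.Finite := (PartialSeq.finite_setOf_dom_subset_Iio l).union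
      ((Finset.finite_toSet _).image z)
    have hK' : ∀ x ∈ K, x.dom.Finite ∨ x ∈ range z := by
      rintro x (hx | ⟨i, -, rfl⟩)
      · exact Or.inl ((finite_Iio l).subset hx)
      · exact Or.inr ⟨i, rfl⟩
    choose B hBW hBK using fun n => hW n K hK hK'
    have hlen : (List.ofFn fun i : Fin l => B i).length = l := by simp
    refine ⟨l, ⟨List.ofFn fun i : Fin l => B i, ?_, hlen⟩,
      lt_of_lt_of_le (Nat.lt_succ_self N) (le_max_right _ _)⟩
    refine mem_iInter₂.2 ?_
    rintro (k | i) hk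
    · refine ⟨⟨fun i h => ?_, fun x hx C hC => ?_⟩, ?_⟩
      · simpa using hBW i
      · obtain ⟨i, rfl⟩ := List.mem_ofFn.1 hC
        rw [hlen] at hx
        exact hBK i (Or.inl hx)
      · rw [hlen]
        exact (hM k hk).trans (le_max_left _ _)
    · intro C hC
      obtain ⟨j, rfl⟩ := List.mem_ofFn.1 hC
      exact hBK j (Or.inr ⟨i, by simpa using hk, rfl⟩))
  have hpick : ∀ N : ℕ, ∃ q, q ∈ R ∧ q ∈ Good ∧ N < q.length := by
    intro N
    obtain ⟨q, hq, hq'⟩ := (hR.sdiff (hRD (Sum.inl (N + 1)))).nonempty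
    have h : q ∈ D (Sum.inl (N + 1)) := by
      by_contra h
      exact hq' ⟨hq, h⟩
    exact ⟨q, hq, h.1, h.2⟩
  choose pick hpickR hpickG hpickN using hpick
  have hgap : ∀ q : List (TopologicalSpace.Clopens PartialSeq), ∃ m : ℕ, q ∈ Good →
      ∀ x : PartialSeq, Disjoint x.dom (Ico q.length m) → ∀ B ∈ q, x ∈ B := by
    intro q
    by_cases hq : q ∈ Good
    · obtain ⟨m, hm⟩ := PartialSeq.exists_gap q.length (⋂ B ∈ {B | B ∈ q}, (B : Set PartialSeq))
        ((List.finite_toSet q).isOpen_biInter fun B _ => B.isClopen.isOpen)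
        (fun x hx => mem_iInter₂.2 fun B hB => hq.2 x hx B hB)
      exact ⟨m, fun _ x hx B hB => mem_iInter₂.1 (hm x hx) B hB⟩
    · exact ⟨0, fun h => absurd h hq⟩
  choose m hm using hgap
  choose g hgP hgN using fun N : ℕ => hP.exists_gt N
  -- Lists and elements of `P` alternate: `a j` lies beyond the gap of `q j`, and `q (j + 1)` is
  -- longer than `a j`. Hence the range of `a` misses every gap.
  let q : ℕ → List (TopologicalSpace.Clopens PartialSeq) := fun j =>
    Nat.rec (pick 0) (fun _ q => pick (g (max (m q) q.length))) j
  let a : ℕ → ℕ := fun j => g (max (m (q j)) (q j).length)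
  have hqs : ∀ j, q (j + 1) = pick (a j) := fun j => rfl
  have hqR : ∀ j, q j ∈ R := by
    rintro (_ | j)
    · exact hpickR 0
    · exact hpickR _
  have hqG : ∀ j, q j ∈ Good := by
    rintro (_ | j)
    · exact hpickG 0
    · exact hpickG _
  have ham : ∀ j, m (q j) < a j := fun j => (le_max_left _ _).trans_lt (hgN _)
  have hal : ∀ j, (q j).length < a j := fun j => (le_max_right _ _).trans_lt (hgN _)
  have hla : ∀ j, a j < (q (j + 1)).length := fun j => hpickN _
  have hlmono : StrictMono fun j => (q j).length :=
    strictMono_nat_of_lt_succ fun j => (hal j).trans (hla j)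
  have hamono : StrictMono a := strictMono_nat_of_lt_succ fun j => (hla j).trans (hal (j + 1))
  have hqinj : Function.Injective q := fun i j h => hlmono.injective (congrArg List.length h)
  have hex : ∀ n, ∃ j, n < (q j).length := fun n =>
    ⟨n + 1, lt_of_lt_of_le (Nat.lt_succ_self n) (hlmono.id_le (n + 1))⟩
  let J : ℕ → ℕ := fun n => Nat.find (hex n)
  have hJ : ∀ n, n < (q (J n)).length := fun n => Nat.find_spec (hex n)
  have hJtop : Tendsto J atTop atTop := by
    refine tendsto_atTop.2 fun k => ?_
    filter_upwards [eventually_ge_atTop (q k).length] with n hn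
    by_contra hlt
    exact absurd (hJ n) (not_lt.2 ((hlmono.monotone (not_le.1 hlt).le).trans hn))
  refine ⟨range a, infinite_range_of_injective hamono.injective, fun i => ?_,
    fun n => (q (J n))[n]'(hJ n), fun n => (hqG (J n)).1 n (hJ n), fun i => ?_, fun x hx => ?_⟩
  · refine (hPT i).subset (sdiff_subset_sdiff_left ?_)
    rintro _ ⟨j, rfl⟩
    exact hgP _
  · have h1 : ∀ᶠ j in atTop, q j ∈ D (Sum.inr i) := by
      rw [← Nat.cofinite_eq_atTop]
      refine ((hRD (Sum.inr i)).preimage hqinj.injOn).subset ?_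
      intro j hj
      exact ⟨hqR j, hj⟩
    filter_upwards [hJtop.eventually h1] with n hn
    exact hn _ (List.getElem_mem _)
  · obtain ⟨N, hN⟩ := hx.bddAbove
    filter_upwards [hJtop.eventually (eventually_gt_atTop N)] with n hn
    refine hm _ (hqG _) x ?_ _ (List.getElem_mem _)
    refine Set.disjoint_left.2 fun k hk hk' => ?_
    have hNk : N < k := lt_of_lt_of_le (hn.trans_le (hlmono.id_le _)) hk'.1
    have hkA : k ∈ range a := by
      by_contra h
      exact absurd (hN ⟨hk, h⟩) (not_le.2 hNk)
    obtain ⟨i, rfl⟩ := hkA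
    rcases lt_or_ge i (J n) with h | h
    · exact absurd hk'.1 (not_le.2 ((hla i).trans_le (hlmono.monotone h)))
    · exact absurd hk'.2 (not_lt.2 ((ham (J n)).le.trans (hamono.monotone h)))

/-! ### Coding the Cantor space -/

open Classical in
/-- The partial sequence with domain `A` whose values on `A`, in increasing order, are the terms
of `r`. -/
noncomputable def PartialSeq.code (A : Set ℕ) (r : ℕ → Bool) : PartialSeq :=
  fun n => if n ∈ A then (if r (Nat.count (· ∈ A) n) then 2 else 1) else 0

open Classical in
/-- The sequence of values of a partial sequence, in the increasing order of its domain. -/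
noncomputable def PartialSeq.decode (x : PartialSeq) : ℕ → Bool :=
  fun i => decide (x (Nat.nth (· ∈ x.dom) i) = 2)

theorem PartialSeq.dom_code (A : Set ℕ) (r : ℕ → Bool) : (PartialSeq.code A r).dom = A := by
  ext n
  rw [PartialSeq.mem_dom, PartialSeq.code]
  split_ifs <;> simp_all

theorem PartialSeq.decode_code {A : Set ℕ} (hA : A.Infinite) (r : ℕ → Bool) :
    (PartialSeq.code A r).decode = r := by
  classical
  ext1 i
  have h1 : Nat.nth (· ∈ A) i ∈ A := Nat.nth_mem_of_infinite (p := (· ∈ A)) hA i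
  have h2 : Nat.count (· ∈ A) (Nat.nth (· ∈ A) i) = i :=
    Nat.count_nth_of_infinite (p := (· ∈ A)) hA i
  rw [PartialSeq.decode, PartialSeq.dom_code]
  have h3 : PartialSeq.code A r (Nat.nth (· ∈ A) i) = if r i then 2 else 1 := by
    rw [PartialSeq.code, if_pos h1]
    congr 3
  rw [h3]
  cases r i <;> simp

/-- The `i`-th decoded value depends only on the entries up to the `i`-th element of the domain. -/
theorem PartialSeq.continuousAt_decode {x : PartialSeq} (hx : x.dom.Infinite) :
    ContinuousAt PartialSeq.decode x := by
  classical
  rw [continuousAt_pi]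
  intro i
  refine ContinuousAt.congr (f := fun _ => x.decode i) continuousAt_const ?_
  have hN : Nat.nth (· ∈ x.dom) i ∈ x.dom := Nat.nth_mem_of_infinite (p := (· ∈ x.dom)) hx i
  have hc : Nat.count (· ∈ x.dom) (Nat.nth (· ∈ x.dom) i) = i :=
    Nat.count_nth_of_infinite (p := (· ∈ x.dom)) hx i
  set N := Nat.nth (· ∈ x.dom) i with hNdef
  have hev : ∀ᶠ y : PartialSeq in 𝓝 x, ∀ n ∈ Iic N, y n = x n := by
    rw [eventually_all_finite (finite_Iic N)]
    intro n _
    exact (continuous_apply n).continuousAt.eventually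
      ((isOpen_discrete {x n}).mem_nhds rfl)
  filter_upwards [hev] with y hy
  have hyN : N ∈ y.dom := by
    rw [PartialSeq.mem_dom, hy N (mem_Iic.2 le_rfl)]
    exact hN
  have hcy : Nat.count (· ∈ y.dom) N = i := by
    rw [← hc, Nat.count_eq_card_filter_range, Nat.count_eq_card_filter_range]
    congr 1
    refine Finset.filter_congr fun n hn => ?_
    rw [PartialSeq.mem_dom, PartialSeq.mem_dom, hy n (Finset.mem_range.1 hn).le]
  have hnth : Nat.nth (· ∈ y.dom) i = N := by
    rw [← hcy]
    exact Nat.nth_count (p := (· ∈ y.dom)) hyN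
  rw [PartialSeq.decode, PartialSeq.decode, hnth, ← hNdef, hy N (mem_Iic.2 le_rfl)]

/-! ### Transfinite construction -/

/-- Dependent choice along a well-founded order. -/
theorem exists_forall_of_wellFoundedLT {I β : Type*} [Preorder I] [WellFoundedLT I] [Nonempty β]
    (Φ : ∀ a : I, (∀ b, b < a → β) → β → Prop)
    (h : ∀ a g, (∀ b (hb : b < a), Φ b (fun c hc => g c (hc.trans hb)) (g b hb)) → ∃ y, Φ a g y) :
    ∃ F : I → β, ∀ a, Φ a (fun b _ => F b) (F a) := by
  classical
  let F : I → β := wellFounded_lt.fix fun a g => Classical.epsilon (Φ a g)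
  have hF : ∀ a, F a = Classical.epsilon (Φ a fun b _ => F b) := fun a => wellFounded_lt.fix_eq _ a
  refine ⟨F, fun a => ?_⟩
  induction a using WellFoundedLT.induction with
  | _ a ih =>
    have := Classical.epsilon_spec (h a (fun b _ => F b) fun b hb => ih b hb)
    rwa [← hF] at this

/-- If `𝔭 = 𝔠`, there is a set of partial sequences which contains all those with finite domain,
which satisfies a selection principle for clopen `ω`-covers, and on which `decode` is onto. -/
theorem exists_partialSeq_set (h_pc : pseudoIntersectionNumber = Cardinal.continuum.{0}) :
    ∃ X : Set PartialSeq, (∀ x : PartialSeq, x.dom.Finite → x ∈ X) ∧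
      (∀ r, ∃ x ∈ X, x.dom.Infinite ∧ x.decode = r) ∧
      ∀ W : ℕ → Set (TopologicalSpace.Clopens PartialSeq),
        (∀ n, ∀ K : Set PartialSeq, K.Finite → K ⊆ X → ∃ B ∈ W n, K ⊆ B) →
        ∃ b : ℕ → TopologicalSpace.Clopens PartialSeq, (∀ n, b n ∈ W n) ∧
          ∀ x ∈ X, ∀ᶠ n in atTop, x ∈ b n := by
  classical
  let I := Cardinal.continuum.{0}.ord.ToType
  have hcount : Countable (TopologicalSpace.Clopens PartialSeq) :=
    TopologicalSpace.Clopens.countable_iff_secondCountable.2 inferInstance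
  have hcard : Cardinal.mk ((ℕ → Set (TopologicalSpace.Clopens PartialSeq)) × (ℕ → Bool)) ≤
      Cardinal.mk I := by
    have h1 : Cardinal.mk (ℕ → Set (TopologicalSpace.Clopens PartialSeq)) ≤
        Cardinal.continuum := by
      rw [Cardinal.mk_arrow]
      simp only [Cardinal.lift_id, Cardinal.mk_set, Cardinal.mk_nat, ← Cardinal.power_mul]
      rw [← Cardinal.two_power_aleph0]
      refine Cardinal.power_le_power_left two_ne_zero ?_
      refine (mul_le_mul' (Cardinal.mk_le_aleph0 (α := TopologicalSpace.Clopens PartialSeq))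
        le_rfl).trans ?_
      rw [Cardinal.aleph0_mul_aleph0]
    rw [Cardinal.mk_ord_toType, Cardinal.mk_prod]
    simp only [Cardinal.lift_id]
    refine (mul_le_mul' h1 (le_of_eq ?_)).trans Cardinal.continuum_mul_self.le
    simp
  obtain ⟨⟨emb, hemb⟩⟩ := hcard
  -- There are only 𝔠 pairs of a sequence of clopen families and a Boolean sequence, so each pair
  -- gets a stage.
  have hsurj := Function.invFun_surjective hemb
  obtain ⟨e, he⟩ : ∃ e : I → (ℕ → Set (TopologicalSpace.Clopens PartialSeq)) × (ℕ → Bool),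
    Function.Surjective e := ⟨_, hsurj⟩
  obtain ⟨A, hA⟩ := exists_forall_of_wellFoundedLT (I := I) (β := Set ℕ)
    (fun a g Y => Y.Infinite ∧ (∀ b hb, (Y \ g b hb).Finite) ∧
      ((∀ n, ∀ K : Set PartialSeq, K.Finite → (∀ x ∈ K, x.dom.Finite ∨
          x ∈ range fun c : Iio a => PartialSeq.code (g c c.2) (e c).2) →
          ∃ B ∈ (e a).1 n, K ⊆ B) →
        ∃ b : ℕ → TopologicalSpace.Clopens PartialSeq, (∀ n, b n ∈ (e a).1 n) ∧
          (∀ c : Iio a, ∀ᶠ n in atTop, PartialSeq.code (g c c.2) (e c).2 ∈ b n) ∧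
          ∀ x : PartialSeq, (x.dom \ Y).Finite → ∀ᶠ n in atTop, x ∈ b n)) (by
    intro a g hg
    have hι : Cardinal.mk (Iio a) < pseudoIntersectionNumber := by
      rw [h_pc]
      exact (Cardinal.mk_Iio_lt a (by simp [I])).trans_eq (Cardinal.mk_ord_toType _)
    have hω : Cardinal.aleph0 < pseudoIntersectionNumber := by
      rw [h_pc]
      exact Cardinal.aleph0_lt_continuum
    have hT : ∀ s : Finset (Iio a), (⋂ i ∈ s, g i i.2).Infinite := by
      intro s
      rcases s.eq_empty_or_nonempty with rfl | hs
      · simpa using Set.infinite_univ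
      · obtain ⟨m, hm, hmax⟩ := s.exists_max_image id hs
        have hfin : (⋃ i ∈ s, g m m.2 \ g i i.2).Finite := by
          refine s.finite_toSet.biUnion fun i hi => ?_
          rcases (hmax i hi).lt_or_eq with h | h
          · exact (hg m m.2).2.1 i h
          · have : i = m := h
            subst this
            simp
        refine ((hg m m.2).1.sdiff hfin).mono ?_
        intro k hk
        refine mem_iInter₂.2 fun i hi => ?_
        by_contra h
        exact hk.2 (mem_iUnion₂.2 ⟨i, hi, hk.1, h⟩)
    -- If the families at this stage fail to cover, nothing has to be selected and any
    -- pseudo-intersection will do.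
    by_cases hcov : ∀ n, ∀ K : Set PartialSeq, K.Finite → (∀ x ∈ K, x.dom.Finite ∨
          x ∈ range fun c : Iio a => PartialSeq.code (g c c.2) (e c).2) →
          ∃ B ∈ (e a).1 n, K ⊆ B
    · obtain ⟨Y, hY, hYg, hYb⟩ := exists_absorbing_pseudoIntersection hι hω
        (fun i : Iio a => g i i.2) hT (fun c : Iio a => PartialSeq.code (g c c.2) (e c).2)
        (e a).1 hcov
      exact ⟨Y, hY, fun b hb => hYg ⟨b, hb⟩, fun _ => hYb⟩
    · obtain ⟨Y, hY, hYg⟩ := exists_pseudoIntersection_of_lt (fun i : Iio a => g i i.2) hι hT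
      exact ⟨Y, hY, fun b hb => hYg ⟨b, hb⟩, fun h => absurd h hcov⟩)
  refine ⟨{x | x.dom.Finite} ∪ range fun a => PartialSeq.code (A a) (e a).2, fun x hx => Or.inl hx,
    fun r => ?_, fun W hW => ?_⟩
  · obtain ⟨a, ha⟩ := he (fun _ => ∅, r)
    refine ⟨_, Or.inr ⟨a, rfl⟩, ?_, ?_⟩
    · rw [PartialSeq.dom_code]
      exact (hA a).1
    · rw [PartialSeq.decode_code (hA a).1, ha]
  · obtain ⟨a, ha⟩ := he (W, fun _ => false)
    have ha1 : (e a).1 = W := by rw [ha]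
    obtain ⟨b, hbW, hb1, hb2⟩ := (hA a).2.2 (by
      intro n K hK hKX
      rw [ha1]
      refine hW n K hK fun x hx => ?_
      rcases hKX x hx with h | ⟨c, rfl⟩
      · exact Or.inl h
      · exact Or.inr ⟨c, rfl⟩)
    refine ⟨b, fun n => ha1 ▸ hbW n, ?_⟩
    rintro x (hx | ⟨c, rfl⟩)
    · exact hb2 x (Set.Finite.subset hx sdiff_subset)
    · rcases lt_trichotomy c a with h | rfl | h
      · exact hb1 ⟨c, h⟩
      · refine hb2 _ ?_
        rw [PartialSeq.dom_code]
        simp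
      · refine hb2 _ ?_
        rw [PartialSeq.dom_code]
        exact (hA c).2.1 a h

/-! ### Open covers and continuous functions -/

/-- Selection of members of families of open sets such that every point eventually belongs to the
selected sets. -/
def SelectsEventually (X : Type*) [TopologicalSpace X] : Prop :=
  ∀ A : ℕ → Set (Set X), (∀ n, ∀ V ∈ A n, IsOpen V) →
    (∀ n, ∀ K : Set X, K.Finite → ∃ V ∈ A n, K ⊆ V) →
    ∃ b : ℕ → Set X, (∀ n, b n ∈ A n) ∧ ∀ x, ∀ᶠ n in atTop, x ∈ b n

/-- With a finite range, some set would recur infinitely often; it would contain every point, which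
`hb` excludes. -/
theorem isGammaCover_range {X : Type*} {b : ℕ → Set X} (hb : ∀ n, b n ≠ univ)
    (h : ∀ x, ∀ᶠ n in atTop, x ∈ b n) : IsGammaCover (range b) := by
  constructor
  · intro hfin
    obtain ⟨V, -, hV⟩ : ∃ V ∈ hfin.toFinset, ∃ᶠ n in atTop, b n = V := by
      by_contra! hcon
      have : ∀ᶠ n in atTop, ∀ V ∈ hfin.toFinset, b n ≠ V := by
        rw [Finset.eventually_all]
        intro V hV
        simpa using hcon V hV
      obtain ⟨n, hn⟩ := this.exists
      exact hn (b n) (by simp) rfl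
    obtain ⟨n, hn⟩ := hV.exists
    refine hb n (eq_univ_of_forall fun x => ?_)
    obtain ⟨k, hk, hk'⟩ := (hV.and_eventually (h x)).exists
    rwa [hn, ← hk]
  · intro x
    obtain ⟨N, hN⟩ := eventually_atTop.1 (h x)
    refine ((finite_Iio N).image b).subset ?_
    rintro _ ⟨⟨n, rfl⟩, hn⟩
    exact ⟨n, not_le.1 fun hle => hn (hN n hle), rfl⟩

theorem SelectsEventually.selectionOne {X : Type*} [TopologicalSpace X]
    (h : SelectsEventually X) : SelectionOne (openOmega X) (openGamma X) := by
  intro A hA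
  obtain ⟨b, hb, hx⟩ := h A (fun n => (hA n).1) (fun n => (hA n).2.2)
  refine ⟨b, hb, ?_, isGammaCover_range (fun n hn => (hA n).2.1 (hn ▸ hb n)) hx⟩
  rintro _ ⟨n, rfl⟩
  exact (hA n).1 _ (hb n)

theorem SelectionOne.isGammaSet {X : Type*} [TopologicalSpace X]
    (h : SelectionOne (openOmega X) (openGamma X)) : IsGammaSet X :=
  fun U hU => h (fun _ => U) fun _ => hU

/-- Density in a set of real functions with the topology of pointwise convergence. -/
theorem dense_iff_forall_finite {X : Type*} {S : Set (X → ℝ)} {D : Set S} :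
    Dense D ↔ ∀ f : S, ∀ K : Set X, K.Finite → ∀ ε > 0,
      ∃ d ∈ D, ∀ x ∈ K, |d.1 x - f.1 x| < ε := by
  constructor
  · intro hD f K hK ε hε
    have hopen : IsOpen {d : S | ∀ x ∈ K, |d.1 x - f.1 x| < ε} := by
      have : {d : S | ∀ x ∈ K, |d.1 x - f.1 x| < ε} =
          ⋂ x ∈ K, {d : S | |d.1 x - f.1 x| < ε} := by
        ext d
        simp
      rw [this]
      refine hK.isOpen_biInter fun x _ => isOpen_lt ?_ continuous_const
      exact (((continuous_apply x).comp continuous_subtype_val).sub continuous_const).abs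
    obtain ⟨d, hd, hdD⟩ := hD.inter_open_nonempty _ hopen ⟨f, fun x _ => by simpa using hε⟩
    exact ⟨d, hdD, hd⟩
  · intro h f
    rw [mem_closure_iff_nhds]
    intro t ht
    rw [nhds_subtype_eq_comap, mem_comap] at ht
    obtain ⟨u, hu, hut⟩ := ht
    rw [nhds_pi, Filter.mem_pi] at hu
    obtain ⟨K, hK, v, hv, hvu⟩ := hu
    choose ε hε hεv using fun x => Metric.mem_nhds_iff.1 (hv x)
    obtain ⟨δ, hδ, hδε⟩ : ∃ δ > 0, ∀ x ∈ K, δ ≤ ε x := by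
      rcases K.eq_empty_or_nonempty with rfl | hne
      · exact ⟨1, one_pos, by simp⟩
      · obtain ⟨m, -, hm⟩ := Set.exists_min_image K ε hK hne
        exact ⟨ε m, hε m, hm⟩
    obtain ⟨d, hdD, hd⟩ := h f K hK δ hδ
    refine ⟨d, hut (hvu fun x hx => hεv x ?_), hdD⟩
    rw [Metric.mem_ball, Real.dist_eq]
    exact (hd x hx).trans_le (hδε x hx)

theorem tendsto_subtype_pi_iff {X : Type*} {S : Set (X → ℝ)} {u : ℕ → S} {f : S} :
    Tendsto u atTop (𝓝 f) ↔ ∀ x, Tendsto (fun n => (u n).1 x) atTop (𝓝 (f.1 x)) := by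
  rw [tendsto_subtype_rng, tendsto_pi_nhds]

/-- Selection is applied to the open sets where members of `D` approximate `f` within `1 / (n + 1)`.
-/
theorem SelectsEventually.seqClosure_eq_univ {X : Type*} [TopologicalSpace X]
    (h : SelectsEventually X) (D : Set (Cp X)) (hD : Dense D) : seqClosure D = univ := by
  refine eq_univ_of_forall fun f => ?_
  rw [dense_iff_forall_finite] at hD
  obtain ⟨b, hb, hbx⟩ := h
    (fun n => (fun d : Cp X => {x | |d.1 x - f.1 x| < 1 / ((n : ℝ) + 1)}) '' D)
    (by
      rintro n _ ⟨d, -, rfl⟩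
      exact isOpen_lt (d.2.sub f.2).abs continuous_const)
    (by
      intro n K hK
      obtain ⟨d, hd, hdK⟩ := hD f K hK (1 / ((n : ℝ) + 1)) Nat.one_div_pos_of_nat
      exact ⟨_, ⟨d, hd, rfl⟩, hdK⟩)
  choose d hd hdb using hb
  refine ⟨d, hd, tendsto_subtype_pi_iff.2 fun x => ?_⟩
  rw [tendsto_iff_dist_tendsto_zero]
  refine squeeze_zero' (.of_forall fun n => dist_nonneg) ?_
    tendsto_one_div_add_atTop_nhds_zero_nat
  filter_upwards [hbx x] with n hn
  rw [← hdb n] at hn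
  exact hn.le

/-- Finitely many values of a real function on a subset of the line are attained by a continuous
function on the line. -/
theorem exists_continuousMap_eqOn {X : Set ℝ} (f : X → ℝ) {K : Set X} (hK : K.Finite) :
    ∃ g : C(ℝ, ℝ), ∀ x ∈ K, g x = f x := by
  classical
  refine ⟨⟨fun t => (Lagrange.interpolate hK.toFinset (fun x : X => (x : ℝ)) f).eval t,
    Polynomial.continuous _⟩, fun x hx => ?_⟩
  exact Lagrange.eval_interpolate_at_node (v := fun x : X => (x : ℝ)) f
    Subtype.val_injective.injOn (hK.mem_toFinset.2 hx)

theorem exists_seq_continuousMap_dense (X : Set ℝ) :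
    ∃ d : ℕ → C(ℝ, ℝ), ∀ f : X → ℝ, ∀ K : Set X, K.Finite → ∀ ε > 0,
      ∃ n, ∀ x ∈ K, |d n x - f x| < ε := by
  refine ⟨TopologicalSpace.denseSeq C(ℝ, ℝ), fun f K hK ε hε => ?_⟩
  obtain ⟨g, hg⟩ := exists_continuousMap_eqOn f hK
  have hopen : IsOpen {d : C(ℝ, ℝ) | ∀ x ∈ K, |d x - f x| < ε} := by
    have : {d : C(ℝ, ℝ) | ∀ x ∈ K, |d x - f x| < ε} =
        ⋂ x ∈ K, {d : C(ℝ, ℝ) | |d x - f x| < ε} := by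
      ext d
      simp
    rw [this]
    refine hK.isOpen_biInter fun x _ => isOpen_lt ?_ continuous_const
    exact ((continuous_eval_const (x : ℝ)).sub continuous_const).abs
  obtain ⟨_, hd, n, rfl⟩ := (TopologicalSpace.denseRange_denseSeq C(ℝ, ℝ)).inter_open_nonempty _
    hopen ⟨g, fun x hx => by simpa [hg x hx] using hε⟩
  exact ⟨n, hd⟩

theorem SelectsEventually.stronglySequentiallySeparable_Cp {X : Set ℝ}
    (h : SelectsEventually X) : StronglySequentiallySeparable (Cp X) := by
  refine ⟨?_, fun D _ hD => h.seqClosure_eq_univ D hD⟩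
  obtain ⟨d, hd⟩ := exists_seq_continuousMap_dense X
  refine ⟨range fun n => (⟨fun x => d n x, (d n).continuous.comp continuous_subtype_val⟩ : Cp X),
    countable_range _, ?_⟩
  rw [dense_iff_forall_finite]
  intro f K hK ε hε
  obtain ⟨n, hn⟩ := hd f.1 K hK ε hε
  exact ⟨_, ⟨n, rfl⟩, hn⟩

/-! ### Closed covers and first-class functions -/

/-- Every countable family of closed sets which absorbs the finite sets contains a sequence such
that every point eventually belongs to the terms of the sequence. -/
def ClosedSubselects (X : Type*) [TopologicalSpace X] : Prop :=
  ∀ U : Set (Set X), U.Countable → (∀ V ∈ U, IsClosed V) →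
    (∀ K : Set X, K.Finite → ∃ V ∈ U, K ⊆ V) →
    ∃ b : ℕ → Set X, (∀ n, b n ∈ U) ∧ ∀ x, ∀ᶠ n in atTop, x ∈ b n

theorem SelectionOne.closedSubselects {X : Type*} [TopologicalSpace X]
    (h : SelectionOne (closedOmega X) (closedGamma X)) : ClosedSubselects X := by
  intro U hUc hU hUK
  by_cases huniv : univ ∈ U
  · exact ⟨fun _ => univ, fun _ => huniv, fun x => .of_forall fun _ => mem_univ x⟩
  obtain ⟨b, hb, -, -, hinf, hfin⟩ := h (fun _ => U) fun _ => ⟨hUc, hU, huniv, hUK⟩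
  have : Infinite (range b) := hinf.to_subtype
  -- The sequence `b` may repeat a set infinitely often, so distinct members of its range are listed
  -- instead.
  let e := Infinite.natEmbedding (range b)
  refine ⟨fun n => e n, fun n => ?_, fun x => ?_⟩
  · obtain ⟨k, hk⟩ := (e n).2
    change ((e n : Set X)) ∈ U
    rw [← hk]
    exact hb k
  · rw [← Nat.cofinite_eq_atTop]
    refine ((hfin x).preimage (Subtype.val_injective.comp e.injective).injOn).subset ?_
    intro n hn
    exact ⟨(e n).2, hn⟩

theorem mem_baireOne_of_isClosed {X : Set ℝ} (d : C(ℝ, ℝ)) {V : Set X} (hV : IsClosed V) :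
    (fun x : X => d x * V.indicator 1 x + (1 - V.indicator 1 x)) ∈ BaireOne X := by
  have hpos : ∀ n : ℕ, (0 : ℝ) < 1 / ((n : ℝ) + 1) := fun n => Nat.one_div_pos_of_nat
  have hlim := thickenedIndicator_tendsto_indicator_closure hpos
    tendsto_one_div_add_atTop_nhds_zero_nat V
  rw [hV.closure_eq, tendsto_pi_nhds] at hlim
  refine ⟨fun n x => d x * (thickenedIndicator (hpos n) V x : ℝ) +
    (1 - (thickenedIndicator (hpos n) V x : ℝ)), fun n => ?_, fun x => ?_⟩
  · have h1 : Continuous fun x : X => (thickenedIndicator (hpos n) V x : ℝ) :=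
      NNReal.continuous_coe.comp (thickenedIndicator (hpos n) V).continuous
    exact ((d.continuous.comp continuous_subtype_val).mul h1).add (continuous_const.sub h1)
  · have h1 : Tendsto (fun n => (thickenedIndicator (hpos n) V x : ℝ)) atTop
        (𝓝 (V.indicator 1 x)) := by
      have h2 : (V.indicator 1 x : ℝ) = (V.indicator (fun _ => (1 : NNReal)) x : NNReal) := by
        by_cases hx : x ∈ V <;> simp [hx]
      rw [h2]
      exact (NNReal.continuous_coe.tendsto _).comp (hlim x)
    exact (h1.const_mul _).add (h1.const_sub _)

/-- The functions equal to `d n` on `V` and to 1 off `V` form a countable dense set. If a sequence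
of them tends to 0, each point eventually lies in the corresponding `V`. -/
theorem StronglySequentiallySeparable.closedSubselects {X : Set ℝ}
    (h : StronglySequentiallySeparable (BaireOne X)) : ClosedSubselects X := by
  intro U hUc hU hUK
  obtain ⟨d, hd⟩ := exists_seq_continuousMap_dense X
  have := hUc.to_subtype
  let F : ℕ × U → BaireOne X := fun p => ⟨_, mem_baireOne_of_isClosed (d p.1) (hU p.2 p.2.2)⟩
  have hF : Dense (range F) := by
    rw [dense_iff_forall_finite]
    intro f K hK ε hε
    obtain ⟨n, hn⟩ := hd f.1 K hK ε hε
    obtain ⟨V, hV, hKV⟩ := hUK K hK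
    refine ⟨_, ⟨(n, ⟨V, hV⟩), rfl⟩, fun x hx => ?_⟩
    simpa [F, hKV hx] using hn x hx
  have hzero : (fun _ => 0 : X → ℝ) ∈ BaireOne X :=
    ⟨fun _ _ => 0, fun _ => continuous_const, fun _ => tendsto_const_nhds⟩
  have hmem : (⟨_, hzero⟩ : BaireOne X) ∈ seqClosure (range F) := by
    rw [h.2 _ (countable_range F) hF]
    exact mem_univ _
  obtain ⟨u, hu, hlim⟩ := hmem
  choose p hp using hu
  refine ⟨fun n => (p n).2, fun n => (p n).2.2, fun x => ?_⟩
  have hx := tendsto_subtype_pi_iff.1 hlim x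
  filter_upwards [hx.eventually (gt_mem_nhds one_pos)] with n hn
  by_contra hxn
  rw [← hp n] at hn
  simp [F, hxn] at hn

/-! ### Failure of selection for closed covers -/

/-- If `ClosedSubselects X` holds, then the complement of a countable infinite set is an increasing
union of closed sets. -/
theorem ClosedSubselects.exists_closed_exhaustion {X : Type*} [MetricSpace X]
    (h : ClosedSubselects X) (p : ℕ → X) (hp : Function.Injective p) :
    ∃ E : ℕ → Set X, (∀ k, IsClosed (E k)) ∧ Monotone E ∧ (⋃ k, E k) = (range p)ᶜ := by
  have hFfin : ∀ n, (p '' Iio n).Finite := fun n => (finite_Iio n).image p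
  -- The bound includes `n`, so `p n` lies neither in `p '' Iio n` nor in `C n m`. This forces the
  -- first index of the selected sets to infinity.
  let C : ℕ → ℕ → Set X := fun n m => {x | ∀ i ∈ Iic n, 1 / ((m : ℝ) + 1) ≤ dist x (p i)}
  have hC : ∀ n m, IsClosed (C n m) := by
    intro n m
    have : C n m = ⋂ i ∈ Iic n, {x | 1 / ((m : ℝ) + 1) ≤ dist x (p i)} := by
      ext x
      simp [C]
    rw [this]
    exact isClosed_biInter fun i _ =>
      isClosed_le continuous_const (continuous_id.dist continuous_const)
  have hpC : ∀ i n m, i ≤ n → p i ∉ C n m := by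
    intro i n m hin hi
    have := hi i hin
    rw [dist_self] at this
    exact absurd this (not_le.2 Nat.one_div_pos_of_nat)
  obtain ⟨b, hb, hbx⟩ := h (range fun q : ℕ × ℕ => p '' Iio q.1 ∪ C q.1 q.2) (countable_range _)
    (by
      rintro _ ⟨q, rfl⟩
      exact (hFfin _).isClosed.union (hC _ _))
    (by
      intro K hK
      obtain ⟨n, hn⟩ : ∃ n, ∀ i, p i ∈ K → i < n := by
        obtain ⟨N, hN⟩ := (hK.preimage hp.injOn).bddAbove
        exact ⟨N + 1, fun i hi => Nat.lt_succ_of_le (hN hi)⟩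
      have hev : ∀ x ∈ K \ p '' Iio n, ∀ᶠ m : ℕ in atTop, x ∈ C n m := by
        intro x hx
        have : ∀ i ∈ Iic n, ∀ᶠ m : ℕ in atTop, 1 / ((m : ℝ) + 1) ≤ dist x (p i) := by
          intro i _
          have hne : x ≠ p i := by
            rintro rfl
            exact hx.2 ⟨i, hn i hx.1, rfl⟩
          filter_upwards [tendsto_one_div_add_atTop_nhds_zero_nat.eventually
            (gt_mem_nhds (dist_pos.2 hne))] with m hm using hm.le
        exact (eventually_all_finite (finite_Iic n)).2 this
      obtain ⟨m, hm⟩ := ((eventually_all_finite hK.sdiff).2 hev).exists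
      refine ⟨_, ⟨(n, m), rfl⟩, fun x hx => ?_⟩
      by_cases hxp : x ∈ p '' Iio n
      · exact Or.inl hxp
      · exact Or.inr (hm x ⟨hx, hxp⟩))
  choose q hq using hb
  have hne : ∀ N, ∀ᶠ j in atTop, (q j).1 ≠ N := by
    intro N
    filter_upwards [hbx (p N)] with j hj hjN
    rw [← hq j] at hj
    rcases hj with ⟨i, hi, hiN⟩ | hj
    · exact absurd (hp hiN) (hjN ▸ (mem_Iio.1 hi).ne)
    · exact hpC N _ _ hjN.ge hj
  have htop : ∀ N, ∀ᶠ j in atTop, N < (q j).1 := by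
    intro N
    filter_upwards [(eventually_all_finite (finite_Iic N)).2 fun i _ => hne i] with j hj
    by_contra hle
    exact hj _ (not_lt.1 hle) rfl
  refine ⟨fun k => ⋂ j ∈ Ici k, C (q j).1 (q j).2, fun k => isClosed_biInter fun j _ => hC _ _,
    fun k l hkl => biInter_subset_biInter_left (Ici_subset_Ici.2 hkl), ?_⟩
  ext x
  constructor
  · rintro hx ⟨i, rfl⟩
    obtain ⟨k, hk⟩ := mem_iUnion.1 hx
    obtain ⟨j, hj, hkj⟩ := ((htop i).and (eventually_ge_atTop k)).exists
    exact hpC i _ _ hj.le (mem_iInter₂.1 hk j hkj)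
  · intro hx
    obtain ⟨k, hk⟩ := eventually_atTop.1 (hbx x)
    refine mem_iUnion.2 ⟨k, mem_iInter₂.2 fun j hj => ?_⟩
    have := hk j hj
    rw [← hq j] at this
    rcases this with ⟨i, -, rfl⟩ | h'
    · exact absurd ⟨i, rfl⟩ hx
    · exact h'

/-- `ClosedSubselects X` fails if the Cantor space is a continuous image of the complement of a
countable infinite set. -/
theorem not_closedSubselects {X : Type*} [MetricSpace X] (p : ℕ → X) (hp : Function.Injective p)
    (f : X → ℕ → Bool) (hf : ContinuousOn f (range p)ᶜ) (hsurj : SurjOn f (range p)ᶜ univ) :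
    ¬ ClosedSubselects X := by
  intro h
  obtain ⟨E, hE, hEmono, hEU⟩ := h.exists_closed_exhaustion p hp
  have hEp : ∀ k, E k ⊆ (range p)ᶜ := fun k => hEU ▸ subset_iUnion E k
  -- Via `Nat.pair`, `y` is a sequence of columns; `C k s` says that column `k` disagrees with the
  -- finite word `s`.
  let C : ℕ → List Bool → Set (ℕ → Bool) := fun k s =>
    {y | ∃ i ∈ Iio s.length, y (Nat.pair k i) ≠ s.getD i false}
  have hC : ∀ k s, IsClosed (C k s) := by
    intro k s
    have : C k s = ⋃ i ∈ Iio s.length, {y | y (Nat.pair k i) ∈ ({s.getD i false}ᶜ : Set Bool)} := by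
      ext y
      simp only [C, mem_iUnion, mem_ofPred_eq, mem_compl_iff, mem_singleton_iff, exists_prop, ne_eq]
    rw [this]
    exact (finite_Iio _).isClosed_biUnion fun i _ =>
      (isClosed_discrete _).preimage (continuous_apply _)
  obtain ⟨b, hb, hbx⟩ := h
    (range fun q : ℕ × List Bool => p '' Iio q.1 ∪ E q.1 ∩ f ⁻¹' C q.1 q.2)
    (countable_range _)
    (by
      rintro _ ⟨q, rfl⟩
      exact ((finite_Iio q.1).image p).isClosed.union
        ((hf.mono (hEp _)).preimage_isClosed_of_isClosed (hE _) (hC _ _)))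
    (by
      intro K hK
      obtain ⟨n, hn⟩ : ∃ n, ∀ i, p i ∈ K → i < n := by
        obtain ⟨N, hN⟩ := (hK.preimage hp.injOn).bddAbove
        exact ⟨N + 1, fun i hi => Nat.lt_succ_of_le (hN hi)⟩
      have hev : ∀ x ∈ K \ range p, ∀ᶠ k in atTop, x ∈ E k := by
        intro x hx
        obtain ⟨k, hk⟩ := mem_iUnion.1 (hEU.symm ▸ hx.2 : x ∈ ⋃ k, E k)
        filter_upwards [eventually_ge_atTop k] with l hl using hEmono hl hk
      obtain ⟨k, hk, hnk⟩ :=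
        (((eventually_all_finite hK.sdiff).2 hev).and (eventually_ge_atTop n)).exists
      obtain ⟨z, hz⟩ : ∃ z : ℕ → Bool, z ∉ (fun x i => f x (Nat.pair k i)) '' K :=
        (hK.image _).exists_notMem
      have hev' : ∀ x ∈ K, ∀ᶠ m in atTop, ∃ i ∈ Iio m, f x (Nat.pair k i) ≠ z i := by
        intro x hx
        obtain ⟨i, hi⟩ : ∃ i, f x (Nat.pair k i) ≠ z i := by
          by_contra! hcon
          exact hz ⟨x, hx, funext hcon⟩
        filter_upwards [eventually_gt_atTop i] with m hm using ⟨i, hm, hi⟩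
      obtain ⟨m, hm⟩ := ((eventually_all_finite hK).2 hev').exists
      refine ⟨_, ⟨(k, List.ofFn fun i : Fin m => z i), rfl⟩, fun x hx => ?_⟩
      by_cases hxp : x ∈ range p
      · obtain ⟨i, rfl⟩ := hxp
        exact Or.inl ⟨i, (hn i hx).trans_le hnk, rfl⟩
      · refine Or.inr ⟨hk x ⟨hx, hxp⟩, ?_⟩
        obtain ⟨i, hi, hi'⟩ := hm x hx
        have him : i < m := hi
        exact ⟨i, by simpa using hi, by simpa [List.getD, him] using hi'⟩)
  choose q hq using hb
  have htop : Tendsto (fun j => (q j).1) atTop atTop := by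
    refine tendsto_atTop.2 fun N => ?_
    filter_upwards [hbx (p N)] with j hj
    rw [← hq j] at hj
    rcases hj with ⟨i, hi, hiN⟩ | hj
    · rw [← hp hiN]
      exact (mem_Iio.1 hi).le
    · exact absurd ⟨N, rfl⟩ (hEp _ hj.1)
  obtain ⟨φ, hφ, hφmono⟩ := strictMono_subseq_of_tendsto_atTop htop
  -- Along a subsequence with distinct column indices, each selected column of `y` is made to extend
  -- the selected word, so a preimage of `y` off `range p` avoids all these sets.
  let y : ℕ → Bool := fun n =>
    (q (φ (Function.invFun (fun j => (q (φ j)).1) n.unpair.1))).2.getD n.unpair.2 false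
  obtain ⟨x, hx, hxy⟩ := hsurj (mem_univ y)
  obtain ⟨N, hN⟩ := eventually_atTop.1 (hbx x)
  have hxN := hN (φ N) (hφ.id_le N)
  rw [← hq] at hxN
  rcases hxN with ⟨i, -, hi⟩ | ⟨-, i, -, hi⟩
  · exact hx ⟨i, hi⟩
  · refine hi ?_
    have hinv : Function.invFun (fun j => (q (φ j)).1) (q (φ N)).1 = N :=
      Function.leftInverse_invFun hφmono.injective N
    rw [hxy]
    simp only [y, Nat.unpair_pair]
    rw [hinv]

/-! ### Transfer to the real line -/

/-- The space of partial sequences embeds into the real line. -/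
theorem PartialSeq.exists_isClosedEmbedding_real :
    ∃ φ : PartialSeq → ℝ, IsClosedEmbedding φ := by
  -- Each symbol becomes the indicator sequence of its value. By compactness, continuity and
  -- injectivity suffice for a closed embedding.
  let ψ : PartialSeq → ℕ → ℕ → Bool := fun x n k => decide ((x n : ℕ) = k)
  have hψ : Continuous ψ := continuous_pi fun n => continuous_pi fun k =>
    (continuous_of_discreteTopology (f := fun a : Fin 3 => decide ((a : ℕ) = k))).comp
      (continuous_apply n)
  have hinj : Function.Injective ψ := by
    intro x y hxy
    ext n
    have := congrFun (congrFun hxy n) (x n)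
    simpa [ψ, eq_comm] using this
  let θ : (ℕ → ℕ → Bool) → ℝ := fun w =>
    (cantorSetHomeomorphNatToBool.symm (cantorSpaceHomeomorphNatToCantorSpace.symm w) : ℝ)
  refine ⟨θ ∘ ψ, Continuous.isClosedEmbedding ?_ ?_⟩
  · exact (continuous_subtype_val.comp (cantorSetHomeomorphNatToBool.symm.continuous.comp
      cantorSpaceHomeomorphNatToCantorSpace.symm.continuous)).comp hψ
  · exact (Subtype.val_injective.comp (cantorSetHomeomorphNatToBool.symm.injective.comp
      cantorSpaceHomeomorphNatToCantorSpace.symm.injective)).comp hinj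

theorem PartialSeq.infinite_setOf_finite_dom : {x : PartialSeq | x.dom.Finite}.Infinite := by
  refine Set.infinite_of_injective_forall_mem
    (f := fun n : ℕ => (Pi.single n 1 : PartialSeq)) ?_ fun n => ?_
  · intro m n hmn
    by_contra hne
    have := congrFun hmn m
    simp [Pi.single_eq_of_ne hne] at this
  · refine (finite_singleton n).subset fun k hk => ?_
    by_contra hne
    exact hk (Pi.single_eq_of_ne hne _)

theorem isTopologicalBasis_isClopen_of_isEmbedding {X Y : Type*} [TopologicalSpace X]
    [TopologicalSpace Y] [CompactSpace Y] [T2Space Y] [TotallyDisconnectedSpace Y] {g : X → Y}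
    (hg : IsEmbedding g) : TopologicalSpace.IsTopologicalBasis {V : Set X | IsClopen V} := by
  refine (isTopologicalBasis_isClopen.isInducing hg.isInducing).of_isOpen_of_subset
    (fun V hV => hV.isOpen) ?_
  rintro _ ⟨V, hV, rfl⟩
  exact IsClopen.preimage hV hg.continuous

/-- Open `ω`-covers of a subspace of a zero-dimensional compact space are refined by clopen sets. -/
theorem selectsEventually_of_isEmbedding {X Y : Type*} [TopologicalSpace X]
    [TopologicalSpace Y] [CompactSpace Y] [T2Space Y] [TotallyDisconnectedSpace Y] {g : X → Y}
    (hg : IsEmbedding g)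
    (h : ∀ W : ℕ → Set (TopologicalSpace.Clopens Y),
        (∀ n, ∀ K : Set Y, K.Finite → K ⊆ range g → ∃ B ∈ W n, K ⊆ B) →
        ∃ b : ℕ → TopologicalSpace.Clopens Y, (∀ n, b n ∈ W n) ∧
          ∀ x, ∀ᶠ n in atTop, g x ∈ b n) : SelectsEventually X := by
  intro A hA hAK
  -- Finite sets are closed in `Y`, so a clopen set fits between such a set and an open set
  -- containing it.
  obtain ⟨b, hb, hbx⟩ := h (fun n => {B | ∃ V ∈ A n, g ⁻¹' B ⊆ V}) (by
    intro n K hK hKg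
    obtain ⟨V, hV, hKV⟩ := hAK n (g ⁻¹' K) (hK.preimage hg.injective.injOn)
    obtain ⟨O, hO, rfl⟩ := hg.isInducing.isOpen_iff.1 (hA n V hV)
    obtain ⟨B, hB, hKB, hBO⟩ := exists_clopen_of_closed_subset_open hK.isClosed hO (by
      intro y hy
      obtain ⟨x, rfl⟩ := hKg hy
      exact hKV hy)
    exact ⟨⟨B, hB⟩, ⟨_, hV, preimage_mono hBO⟩, hKB⟩)
  choose V hV hbV using hb
  refine ⟨V, hV, fun x => ?_⟩
  filter_upwards [hbx x] with n hn using hbV n hn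

theorem theorem4p27 (h_pc : pseudoIntersectionNumber = Cardinal.continuum.{0}) :
    ∃ X : Set ℝ,
      -- `X` is zero-dimensional: its clopen subsets form a base
      TopologicalSpace.IsTopologicalBasis {V : Set X | IsClopen V} ∧
      StronglySequentiallySeparable (Cp X) ∧
      ¬ StronglySequentiallySeparable (BaireOne X) ∧
      IsGammaSet X ∧
      (∃ f : X → ℝ, Measurable f ∧ range f = Icc 0 1) ∧
      SelectionOne (openOmega X) (openGamma X) ∧
      ¬ SelectionOne (closedOmega X) (closedGamma X) := by
  classical
  obtain ⟨Y, hYfin, hYdec, hYsel⟩ := exists_partialSeq_set h_pc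
  obtain ⟨φ, hφ⟩ := PartialSeq.exists_isClosedEmbedding_real
  let e : Y ≃ₜ φ '' Y := hφ.isEmbedding.homeomorphImage Y
  let g : φ '' Y → PartialSeq := fun x => e.symm x
  have hg : IsEmbedding g := IsEmbedding.subtypeVal.comp e.symm.isEmbedding
  have hrange : range g = Y := by
    have : range g = range ((↑) : Y → PartialSeq) := e.symm.surjective.range_comp _
    rw [this, Subtype.range_coe]
  have hsel : SelectsEventually (φ '' Y) := by
    refine selectsEventually_of_isEmbedding hg fun W hW => ?_
    obtain ⟨b, hb, hbx⟩ := hYsel W fun n K hK hKY => hW n K hK (hrange.symm ▸ hKY)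
    exact ⟨b, hb, fun x => hbx _ (e.symm x).2⟩
  -- `Q` is the countable exceptional set: `decode` is continuous off it, and the Borel function is
  -- set to 0 on it.
  let Q : Set (φ '' Y) := g ⁻¹' {x | x.dom.Finite}
  have hQc : Q.Countable := PartialSeq.countable_setOf_finite_dom.preimage hg.injective
  have hQi : Q.Infinite := by
    refine PartialSeq.infinite_setOf_finite_dom.preimage ?_
    rw [hrange]
    exact hYfin
  have := hQi.to_subtype
  have := hQc.to_subtype
  obtain ⟨enum⟩ := nonempty_equiv_of_countable (α := ℕ) (β := Q)
  let p : ℕ → φ '' Y := fun n => enum n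
  have hp : Function.Injective p := Subtype.val_injective.comp enum.injective
  have hpQ : range p = Q := by
    have : range p = range ((↑) : Q → φ '' Y) := enum.surjective.range_comp _
    rw [this, Subtype.range_coe]
  let f : φ '' Y → ℕ → Bool := fun x => (g x).decode
  have hf : ContinuousOn f Qᶜ := fun x hx =>
    ((PartialSeq.continuousAt_decode hx).comp hg.continuous.continuousAt).continuousWithinAt
  have hsurj : SurjOn f Qᶜ univ := by
    intro r _
    obtain ⟨x, hxY, hx, hxr⟩ := hYdec r
    obtain ⟨t, rfl⟩ : x ∈ range g := hrange.symm ▸ hxY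
    exact ⟨t, hx, hxr⟩
  have hnot : ¬ ClosedSubselects (φ '' Y) :=
    not_closedSubselects p hp f (hpQ ▸ hf) (hpQ ▸ hsurj)
  obtain ⟨u, hu, husurj⟩ := exists_nat_bool_continuous_surjective_of_compact (Icc (0 : ℝ) 1)
  refine ⟨φ '' Y, isTopologicalBasis_isClopen_of_isEmbedding hg,
    hsel.stronglySequentiallySeparable_Cp, fun h => hnot h.closedSubselects,
    hsel.selectionOne.isGammaSet, ⟨Qᶜ.piecewise (fun x => (u (f x) : ℝ)) (fun _ => 0), ?_, ?_⟩,
    hsel.selectionOne, fun h => hnot h.closedSubselects⟩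
  · exact ContinuousOn.measurable_piecewise ((continuous_subtype_val.comp hu).comp_continuousOn hf)
      continuousOn_const hQc.measurableSet.compl
  · refine Subset.antisymm ?_ fun t ht => ?_
    · rintro _ ⟨x, rfl⟩
      by_cases hx : x ∈ Qᶜ
      · rw [piecewise_eq_of_mem _ _ _ hx]
        exact (u (f x)).2
      · rw [piecewise_eq_of_notMem _ _ _ hx]
        exact ⟨le_rfl, zero_le_one⟩
    · obtain ⟨r, hr⟩ := husurj ⟨t, ht⟩
      obtain ⟨x, hx, rfl⟩ := hsurj (mem_univ r)
      exact ⟨x, by rw [piecewise_eq_of_mem _ _ _ hx, hr]⟩
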